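/- Let $G$ be a finite plane undirected graph; loops, parallel edges, isolated vertices and several connected components are allowed. Write $n_G$ and $f_G$ for its numbers of vertices and faces. A \emph{corner} of $G$ is a pair of half-edges that are consecutive in the clockwise order around a vertex (an isolated vertex has exactly one corner, and a vertex of degree $d\ge 1$ has $d$ corners). A \emph{coating} $H$ of $G$ is a digraph obtained as follows. Replace every vertex $v$ by a directed cycle $C_v$, oriented clockwise, that has one vertex $s_d$ for each half-edge $d$ at $v$, in the clockwise order of the half-edges around $v$, and in addition a number $h(c)\ge 1$ of vertices in each corner $c$ at $v$. For every edge with half-edges $d,d'$, merge $s_d$ and $s_{d'}$ into one vertex and add the two arcs from the in-neighbour of $s_d$ to the out-neighbour of $s_{d'}$ and from the in-neighbour of $s_{d'}$ to the out-neighbour of $s_d$ (in- and out-neighbours are taken on the cycles $C_v$). If the edge is a loop, $s_d$ and $s_{d'}$ are required to be at distance at least $3$ on their cycle. The coating is a \emph{$g$-coating} if every cycle $C_v$ has length $g$ (counted before merging). The \emph{digirth} of a digraph is the length of its shortest directed cycle, and $\mathrm{fvs}(H)$ is the minimum size of a set of vertices of $H$ that meets every directed cycle of $H$. The \emph{fractional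 arboricity} of $G$ is $$a_f(G)=\max\left\{\frac{|E(S)|}{|V(S)|-1} : S \text{ a subgraph of } G \text{ with } |V(S)|\ge 2\right\},$$ with $a_f(G)=0$ if $G$ has fewer than two vertices. Proposition. Let $g$ be a natural number. If $G$ admits a $g$-coating of digirth (exactly) $g$, then $$a_f(G)\le \frac{2g}{g+2}.$$ Moreover, every $g$-coating $H$ of $G$ of digirth $g$ satisfies $\mathrm{fvs}(H)\ge n_G\ge f_G$. -/

import Mathlib

/-- The half-edge opposite to `d`. Every edge `e : E` has the two half-edges `(e, false)` and
`(e, true)`. -/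
def oppHalfEdge {E : Type*} (d : E × Bool) : E × Bool := (d.1, !d.2)

/-- A plane graph with vertex set `V`, edge set `E` and face set `F`, given by its combinatorial
embedding data. Loops, parallel edges, isolated vertices and several components are allowed.

* `vert d` is the end of the half-edge `d`, and `rot d` is the half-edge that follows `d` in the
  clockwise order around `vert d`; so the half-edges at one vertex form one cycle of `rot`.
* `face d` is the face on the right of `d` when `d` is traversed starting from `vert d`; it is the
  face that contains the angle between `d` and `rot d`. Hence the face on the other side of the
  edge is `face (oppHalfEdge d)`, and walking along the boundary of a face leads from `d` to
  `oppHalfEdge (rot d)`.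
* A face of a disconnected plane graph can have several boundary walks, and an isolated vertex
  lies in a face; `outer` is the unbounded face.
* `face_connected`: any two faces can be joined by a curve that avoids the vertices, that is, by
  crossing edges.
* `jordan` (the Jordan curve property, which distinguishes the plane from other surfaces): every
  closed curve made of edges (a set `Z` of edges with even degree at every vertex) separates the
  faces in two sides `X` and `Xᶜ`, and its edges are those with one side in `X` and the other
  one in `Xᶜ`. -/
structure PlaneGraph (V E F : Type*) where
  vert : E × Bool → V
  rot : Equiv.Perm (E × Bool)
  rot_sameCycle : ∀ d d', rot.SameCycle d d' ↔ vert d = vert d'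
  face : E × Bool → F
  face_rot : ∀ d, face (oppHalfEdge (rot d)) = face d
  isolatedFace : {v : V // ∀ d, vert d ≠ v} → F
  outer : F
  face_connected : ∀ X : Set F, (∀ d, face d ∈ X ↔ face (oppHalfEdge d) ∈ X) →
    X = ∅ ∨ X = Set.univ
  jordan : ∀ Z : Set E, (∀ v, Even {d : E × Bool | d.1 ∈ Z ∧ vert d = v}.ncard) →
    ∃ X : Set F, ∀ e, e ∈ Z ↔ Xor (face (e, false) ∈ X) (face (e, true) ∈ X)

/-- A directed cycle: a nonempty cyclic sequence of distinct vertices, each with an arc to the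
next one. (Loops are directed cycles of length one.) -/
def Digraph.IsDirectedCycle {W : Type*} (H : Digraph W) (C : Cycle W) : Prop :=
  C ≠ Cycle.nil ∧ C.Nodup ∧ C.Chain H.Adj

/-- The digirth: the length of a shortest directed cycle (`⊤` if there is none). -/
noncomputable def Digraph.digirth {W : Type*} (H : Digraph W) : ℕ∞ :=
  ⨅ (C : Cycle W) (_ : H.IsDirectedCycle C), (C.length : ℕ∞)

/-- A feedback vertex set: a set of vertices that meets every directed cycle. -/
def Digraph.IsFeedbackVertexSet {W : Type*} (H : Digraph W) (S : Set W) : Prop :=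
  ∀ C : Cycle W, H.IsDirectedCycle C → ∃ x ∈ C, x ∈ S

/-- The minimum size of a (finite) feedback vertex set. -/
noncomputable def Digraph.fvs {W : Type*} (H : Digraph W) : ℕ :=
  sInf {k : ℕ | ∃ S : Finset W, H.IsFeedbackVertexSet (S : Set W) ∧ S.card = k}

namespace PlaneGraph

variable {V E F : Type*} (G : PlaneGraph V E F)

/-- A subgraph of `G`: a set of vertices and a set of edges that contains both ends of each of
these edges. -/
def IsSubgraph (VS : Set V) (ES : Set E) : Prop :=
  ∀ d : E × Bool, d.1 ∈ ES → G.vert d ∈ VS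

/-- The fractional arboricity: the maximum of `m_S / (n_S - 1)` over the subgraphs `S` with at
least two vertices (and `0` if `G` has no such subgraph). -/
noncomputable def fractionalArboricity : ℝ :=
  sSup {x : ℝ | ∃ (VS : Set V) (ES : Set E), G.IsSubgraph VS ES ∧ 2 ≤ VS.ncard ∧
    x = (ES.ncard : ℝ) / ((VS.ncard : ℝ) - 1)}

/-- The corners of `G`. The corner `Sum.inl d` lies between the half-edge `d` and its clockwise
successor `rot d`; an isolated vertex `v` has the single corner `Sum.inr v`. -/
def Corner : Type _ := (E × Bool) ⊕ {v : V // ∀ d, G.vert d ≠ v}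

/-- The vertex at which a corner lies. -/
def cornerVertex : G.Corner → V
  | Sum.inl d => G.vert d
  | Sum.inr v => v.1

/-- A coating of `G`, given by the number `h c ≥ 1` of vertices (other than link vertices) that it
has in each corner `c`; the digraph itself is `Coating.digraph` below. The number is at least one
since link vertices are never adjacent on a cycle. The two link vertices of a loop must be at
distance at least 3 on their cycle before they are merged; this only concerns corners between the
two half-edges of the loop. -/
structure Coating where
  h : G.Corner → ℕ
  h_pos : ∀ c, 0 < h c
  h_loop : ∀ d, G.rot d = oppHalfEdge d → 2 ≤ h (Sum.inl d)

namespace Coating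

variable {G} (H : G.Coating)

/-- The vertices of the disjoint cycles `C_v`, before any merging: one vertex `Sum.inl d` for each
half-edge `d`, and `h c` further vertices for each corner `c`. -/
def PreVertex : Type _ := (E × Bool) ⊕ (Σ c : G.Corner, Fin (H.h c))

/-- The vertex `v` of `G` such that the given vertex belongs to `C_v`. -/
def owner : H.PreVertex → V
  | Sum.inl d => G.vert d
  | Sum.inr x => G.cornerVertex x.1

/-- The successor on the cycles `C_v`, which are directed clockwise: from a half-edge `d`, through
the vertices of the corner between `d` and `rot d`, to the half-edge `rot d`. -/
def next : H.PreVertex → H.PreVertex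
  | Sum.inl d => Sum.inr ⟨Sum.inl d, ⟨0, H.h_pos _⟩⟩
  | Sum.inr ⟨Sum.inl d, i⟩ =>
      if hi : i.1 + 1 < H.h (Sum.inl d) then Sum.inr ⟨Sum.inl d, ⟨i.1 + 1, hi⟩⟩
      else Sum.inl (G.rot d)
  | Sum.inr ⟨Sum.inr v, i⟩ =>
      Sum.inr ⟨Sum.inr v, ⟨(i.1 + 1) % H.h (Sum.inr v), Nat.mod_lt _ (H.h_pos _)⟩⟩

/-- The length of the directed cycle `C_v`. -/
noncomputable def cycleLength (v : V) : ℕ := Nat.card {x : H.PreVertex // H.owner x = v}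

/-- All the cycles `C_v` have length `g`. -/
def IsGCoating (g : ℕ) : Prop := ∀ v, H.cycleLength v = g

/-- The vertices of the coating: a link vertex for each edge, and the vertices in the corners. -/
def Vertex : Type _ := E ⊕ (Σ c : G.Corner, Fin (H.h c))

/-- The merging map: the vertices of the two half-edges of an edge are merged. -/
def merge : H.PreVertex → H.Vertex
  | Sum.inl d => Sum.inl d.1
  | Sum.inr x => Sum.inr x

/-- The coating as a digraph: the arcs of the cycles `C_v`, and for each half-edge `d` the link
arc from the in-neighbour of `d` on its cycle to the out-neighbour of the opposite half-edge on
its cycle. -/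
def digraph : Digraph H.Vertex where
  Adj x y :=
    (∃ s : H.PreVertex, x = H.merge s ∧ y = H.merge (H.next s)) ∨
    (∃ (d : E × Bool) (s : H.PreVertex), H.next s = Sum.inl d ∧ x = H.merge s ∧
      y = H.merge (H.next (Sum.inl (oppHalfEdge d))))

end Coating

end PlaneGraph

/-! For a set `T` of edges, compose the permutation formed by the cycles `C_v` with the exchange of
the two half-edge vertices of every edge in `T`. Skipping the half-edge vertices of `T`, each cycle
of the resulting permutation `reroute T` becomes a closed walk of the coating that uses the link
arcs of `T`, so it contains a directed cycle avoiding the link vertices of `T`. Everything follows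
from counting the cycles of `reroute T`.

Feedback sets: each edge added to `T` is one transposition and loses at most one cycle, so at least
`n - |T|` cycles remain. If `T` consists of the edges whose link vertices lie in a feedback set `S`,
each rerouted cycle contains a corner vertex of `S`, and these are distinct; hence `|S| ≥ n`.

Digirth: each rerouted cycle keeps at least `g` of the `g * n` vertices before merging, while `2 *
|T|` are skipped, so `g * cycles + 2 * |T| ≤ g * n`. For `T` the set of all edges, every face comes
from some rerouted cycle (unless there is only one face), giving `f ≤ n`. For arboricity, planarity
gives the Euler-type bound `|T| + 2 * components ≤ cycles + n`: by the Jordan property, an edge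
added within a component splits a cycle. -/

namespace Equiv.Perm

/-! ### Cycle counts of permutations under transpositions -/

variable {α : Type*}

/-- The number of cycles of a permutation, fixed points included. -/
noncomputable def numCycles (π : Perm α) : ℕ := Nat.card (Quotient (SameCycle.setoid π))

theorem SameCycle.apply_eq_of_invariant {β : Type*} {π : Perm α} {f : α → β}
    (hf : ∀ x, f (π x) = f x) {x y : α} (h : π.SameCycle x y) : f x = f y := by
  obtain ⟨k, rfl⟩ := h
  induction k using Int.induction_on with
  | zero => simp
  | succ k ih => rw [add_comm, zpow_add, zpow_one, mul_apply, hf, ih]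
  | pred k ih =>
    rw [ih, ← hf ((π ^ (-(k : ℤ) - 1)) x), ← mul_apply, ← zpow_one_add]
    congr 3
    ring

theorem card_le_numCycles_of_invariant [Finite α] {β : Type*} (π : Perm α) {f : α → β}
    (hf : ∀ x, f (π x) = f x) (hs : Function.Surjective f) : Nat.card β ≤ π.numCycles :=
  Nat.card_le_card_of_surjective
    (Quotient.lift f fun _ _ h => SameCycle.apply_eq_of_invariant hf h)
    fun b => by
      obtain ⟨a, rfl⟩ := hs b
      exact ⟨Quotient.mk _ a, rfl⟩

theorem sameCycle_of_not_sameCycle_mul_swap [Finite α] [DecidableEq α] (π : Perm α) {a b : α}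
    (h : ¬ (π * swap a b).SameCycle a b) : π.SameCycle a b := by
  set ρ := π * swap a b with hρ
  have hπ : ∀ x, x ≠ a → x ≠ b → π x = ρ x := fun x ha hb => by
    simp [hρ, swap_apply_of_ne_of_ne ha hb]
  have hpa : π a = ρ b := by simp [hρ]
  by_contra hab
  -- the positive iterates of `a` under `π` follow the cycle of `b` under `ρ`
  have key : ∀ k : ℕ, (π ^ (k + 1)) a = (ρ ^ (k + 1)) b := by
    intro k
    induction k with
    | zero => simpa using hpa
    | succ k ih =>
      rw [pow_succ', mul_apply, ih, pow_succ' ρ (k + 1), mul_apply]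
      apply hπ
      · intro h'
        exact h (SameCycle.symm ⟨(k + 1 : ℕ), by rw [zpow_natCast]; exact h'⟩)
      · intro h'
        exact hab ⟨(k + 1 : ℕ), by rw [zpow_natCast, ih]; exact h'⟩
  have hpos : 0 < orderOf ρ := orderOf_pos ρ
  obtain ⟨k, hk⟩ := Nat.exists_eq_succ_of_ne_zero hpos.ne'
  -- Here `k + 1` is the order of `ρ`, so the iterate of `a` under `π` has reached `b`.
  have := key k
  rw [← Nat.succ_eq_add_one, ← hk, pow_orderOf_eq_one] at this
  exact hab ⟨orderOf ρ, by rw [zpow_natCast, this]; rfl⟩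

theorem numCycles_lt_numCycles_mul_swap [Finite α] [DecidableEq α] (π : Perm α) {a b : α}
    (h : ¬ (π * swap a b).SameCycle a b) : π.numCycles < (π * swap a b).numCycles := by
  have hab := sameCycle_of_not_sameCycle_mul_swap π h
  set f : α → Quotient (SameCycle.setoid π) := Quotient.mk _
  have hinv : ∀ x, f ((π * swap a b) x) = f x := by
    intro x
    have h1 : ∀ y, f (π y) = f y := fun y => Quotient.sound (sameCycle_apply_left.2 (.refl _ _))
    have h2 : f a = f b := Quotient.sound hab
    rw [mul_apply, h1]
    by_cases hxa : x = a
    · rw [hxa, swap_apply_left, h2]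
    by_cases hxb : x = b
    · rw [hxb, swap_apply_right, h2]
    rw [swap_apply_of_ne_of_ne hxa hxb]
  set F : Quotient (SameCycle.setoid (π * swap a b)) → Quotient (SameCycle.setoid π) :=
    Quotient.lift f fun _ _ h => SameCycle.apply_eq_of_invariant hinv h
  have hsurj : Function.Surjective F := fun q => by
    induction q using Quotient.inductionOn with
    | h x => exact ⟨Quotient.mk _ x, rfl⟩
  refine lt_of_le_of_ne (Nat.card_le_card_of_surjective F hsurj) fun he => ?_
  have hinj : Function.Injective F :=
    ((Nat.bijective_iff_surjective_and_card F).2 ⟨hsurj, he.symm⟩).1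
  exact h (Quotient.exact (hinj (show F (Quotient.mk _ a) = F (Quotient.mk _ b) from
    Quotient.sound hab)))

theorem numCycles_le_numCycles_mul_swap_add_one [Finite α] [DecidableEq α] (π : Perm α) (a b : α) :
    π.numCycles ≤ (π * swap a b).numCycles + 1 := by
  classical
  set f : α → Quotient (SameCycle.setoid π) := Quotient.mk _
  have h1 : ∀ y, f (π y) = f y := fun y => Quotient.sound (sameCycle_apply_left.2 (.refl _ _))
  have hsurj : Function.Surjective f := Quotient.mk_surjective
  by_cases hab : f a = f b
  · refine (card_le_numCycles_of_invariant (π * swap a b) (f := f) (fun x => ?_) hsurj).trans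
      (Nat.le_succ _)
    rw [mul_apply, h1]
    by_cases hxa : x = a
    · rw [hxa, swap_apply_left, hab]
    by_cases hxb : x = b
    · rw [hxb, swap_apply_right, hab]
    rw [swap_apply_of_ne_of_ne hxa hxb]
  -- Identifying the class of `b` with that of `a` makes the class map invariant and loses exactly
  -- one class.
  · set c : Quotient (SameCycle.setoid π) → {q // q ≠ f b} :=
      fun q => if hq : q = f b then ⟨f a, hab⟩ else ⟨q, hq⟩ with hc
    have hcab : c (f a) = c (f b) := by simp [hc, hab]
    have := card_le_numCycles_of_invariant (π * swap a b) (f := c ∘ f) (fun x => by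
      simp only [Function.comp_apply, mul_apply, h1]
      by_cases hxa : x = a
      · rw [hxa, swap_apply_left, hcab]
      by_cases hxb : x = b
      · rw [hxb, swap_apply_right, hcab]
      rw [swap_apply_of_ne_of_ne hxa hxb]) (Function.Surjective.comp (fun q => ⟨q.1, by
        simp [hc, q.2]⟩) hsurj)
    have hcard : Nat.card {q // q ≠ f b} + 1 = π.numCycles := by
      have := Fintype.ofFinite (Quotient (SameCycle.setoid π))
      have hpos : 0 < Fintype.card (Quotient (SameCycle.setoid π)) :=
        Fintype.card_pos_iff.2 ⟨f b⟩
      rw [numCycles, Nat.card_eq_fintype_card, Nat.card_eq_fintype_card,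
        Fintype.card_subtype_compl, Fintype.card_subtype_eq]
      omega
    omega

end Equiv.Perm

/-! ### Directed cycles inside closed walks -/

theorem Digraph.digirth_le {W : Type*} {H : Digraph W} {C : Cycle W} (hC : H.IsDirectedCycle C) :
    H.digirth ≤ C.length :=
  iInf₂_le C hC

/-- A closed walk, traced by the iterates of a point under a map, contains a directed cycle. -/
theorem Digraph.exists_isDirectedCycle_of_isPeriodicPt {W Q : Type*} (H : Digraph W) (r : Q → Q)
    (f : Q → W) (hr : ∀ x, H.Adj (f x) (f (r x))) {x : Q} {n : ℕ} (hn : 0 < n)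
    (hx : Function.IsPeriodicPt r n x) :
    ∃ C : Cycle W, H.IsDirectedCycle C ∧ C.length ≤ n ∧ ∀ w ∈ C, ∃ i, w = f (r^[i] x) := by
  classical
  -- Distinct points of the orbit may have the same image under `f`. A repetition with the smallest
  -- gap `k` bounds a segment without repeated vertices.
  have hex : ∃ k, 0 < k ∧ ∃ j, f (r^[k + j] x) = f (r^[j] x) :=
    ⟨n, hn, 0, by simp only [add_zero]; rw [hx.eq]; rfl⟩
  obtain ⟨hk, j, hj⟩ := Nat.find_spec hex
  have hmin := fun m => Nat.find_min hex (m := m)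
  have hle : Nat.find hex ≤ n :=
    Nat.find_min' hex ⟨hn, 0, by simp only [add_zero]; rw [hx.eq]; rfl⟩
  generalize Nat.find hex = k at *
  set l : List W := (List.range k).map fun i => f (r^[i + j] x) with hl
  refine ⟨(l : Cycle W), ⟨?_, ?_, ?_⟩, ?_, ?_⟩
  · rw [Ne, Cycle.coe_eq_nil]
    simp [hl, hk.ne']
  · rw [Cycle.nodup_coe_iff, hl]
    refine List.Nodup.map_on ?_ List.nodup_range
    have aux : ∀ i i', i < i' → i' < k → f (r^[i + j] x) ≠ f (r^[i' + j] x) := by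
      intro i i' h h' he
      refine hmin (i' - i) (by omega) ⟨by omega, i + j, ?_⟩
      rw [he]
      congr 2
      omega
    intro i hi i' hi' he
    rw [List.mem_range] at hi hi'
    rcases lt_trichotomy i i' with h | h | h
    · exact (aux _ _ h hi' he).elim
    · exact h
    · exact (aux _ _ h hi he.symm).elim
  · obtain ⟨m, rfl⟩ := Nat.exists_eq_succ_of_ne_zero hk.ne'
    have hstep : ∀ i, H.Adj (f (r^[i + j] x)) (f (r^[i + 1 + j] x)) := fun i => by
      have := hr (r^[i + j] x)
      rwa [← Function.iterate_succ_apply' r, Nat.succ_eq_add_one,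
        show i + j + 1 = i + 1 + j by omega] at this
    rw [hl, ← Cycle.map_coe, Cycle.chain_map, Nat.succ_eq_add_one, Cycle.chain_range_succ]
    refine ⟨?_, fun i _ => hstep i⟩
    have := hstep m
    rw [hj] at this
    rwa [Nat.zero_add]
  · simpa [hl] using hle
  · intro w hw
    simp only [Cycle.mem_coe_iff, hl, List.mem_map] at hw
    obtain ⟨i, -, rfl⟩ := hw
    exact ⟨_, rfl⟩

/-! ### The cycles `C_v` before merging -/

namespace PlaneGraph

variable {V E F : Type*} {G : PlaneGraph V E F}

@[simp] theorem oppHalfEdge_oppHalfEdge (d : E × Bool) : oppHalfEdge (oppHalfEdge d) = d := by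
  simp [oppHalfEdge]

namespace Coating

variable (H : G.Coating)

instance [Finite V] [Finite E] : Finite G.Corner :=
  inferInstanceAs (Finite ((E × Bool) ⊕ {v : V // ∀ d, G.vert d ≠ v}))

instance [Finite V] [Finite E] : Finite H.PreVertex :=
  inferInstanceAs (Finite ((E × Bool) ⊕ (Σ c : G.Corner, Fin (H.h c))))

instance [Finite V] [Finite E] : Finite H.Vertex :=
  inferInstanceAs (Finite (E ⊕ (Σ c : G.Corner, Fin (H.h c))))

/-- The vertex of a half-edge on its cycle. -/
def ofHalfEdge (d : E × Bool) : H.PreVertex := Sum.inl d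

/-- A vertex in a corner, as a vertex on its cycle. -/
def ofCorner (c : Σ c : G.Corner, Fin (H.h c)) : H.PreVertex := Sum.inr c

theorem ofHalfEdge_injective : Function.Injective H.ofHalfEdge := Sum.inl_injective

theorem preVertex_cases (x : H.PreVertex) : (∃ d, x = H.ofHalfEdge d) ∨ ∃ c, x = H.ofCorner c := by
  rcases x with d | c
  exacts [.inl ⟨d, rfl⟩, .inr ⟨c, rfl⟩]

theorem ofCorner_ne_ofHalfEdge (c : Σ c : G.Corner, Fin (H.h c)) (d : E × Bool) :
    H.ofCorner c ≠ H.ofHalfEdge d := Sum.inr_ne_inl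

theorem next_ofHalfEdge (d : E × Bool) :
    H.next (H.ofHalfEdge d) = H.ofCorner ⟨Sum.inl d, ⟨0, H.h_pos _⟩⟩ := rfl

theorem next_ofCorner_inl (d : E × Bool) (i : Fin (H.h (Sum.inl d))) :
    H.next (H.ofCorner ⟨Sum.inl d, i⟩) = if hi : i.1 + 1 < H.h (Sum.inl d) then
      H.ofCorner ⟨Sum.inl d, ⟨i.1 + 1, hi⟩⟩ else H.ofHalfEdge (G.rot d) := rfl

theorem next_ofCorner_inr (v : {v : V // ∀ d, G.vert d ≠ v}) (i : Fin (H.h (Sum.inr v))) :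
    H.next (H.ofCorner ⟨Sum.inr v, i⟩) =
      H.ofCorner ⟨Sum.inr v, ⟨(i.1 + 1) % H.h (Sum.inr v), Nat.mod_lt _ (H.h_pos _)⟩⟩ := rfl

theorem vert_rot (G : PlaneGraph V E F) (d : E × Bool) : G.vert (G.rot d) = G.vert d :=
  (G.rot_sameCycle _ _).1 (Equiv.Perm.sameCycle_apply_left.2 (.refl _ _))

theorem owner_next (x : H.PreVertex) : H.owner (H.next x) = H.owner x := by
  rcases x with d | ⟨d | v, i⟩
  · rfl
  · change H.owner (H.next (H.ofCorner ⟨Sum.inl d, i⟩)) = _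
    rw [next_ofCorner_inl]
    split_ifs
    · rfl
    · exact vert_rot G d
  · rfl

theorem owner_surjective : Function.Surjective H.owner := by
  intro v
  by_cases hv : ∀ d, G.vert d ≠ v
  · exact ⟨H.ofCorner ⟨Sum.inr ⟨v, hv⟩, ⟨0, H.h_pos _⟩⟩, rfl⟩
  · push Not at hv
    obtain ⟨d, hd⟩ := hv
    exact ⟨H.ofHalfEdge d, hd⟩

theorem next_surjective : Function.Surjective H.next := by
  intro y
  rcases y with d | ⟨d | v, i⟩
  · refine ⟨H.ofCorner ⟨Sum.inl (G.rot.symm d), ⟨H.h (Sum.inl (G.rot.symm d)) - 1,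
      Nat.sub_lt (H.h_pos _) one_pos⟩⟩, ?_⟩
    rw [next_ofCorner_inl, dif_neg (by simp only [not_lt]; omega), Equiv.apply_symm_apply]
    rfl
  · obtain ⟨i, hi⟩ := i
    cases i with
    | zero => exact ⟨H.ofHalfEdge d, rfl⟩
    | succ i =>
      refine ⟨H.ofCorner ⟨Sum.inl d, ⟨i, by omega⟩⟩, ?_⟩
      rw [next_ofCorner_inl, dif_pos hi]
      rfl
  · obtain ⟨i, hi⟩ := i
    cases i with
    | zero =>
      refine ⟨H.ofCorner ⟨Sum.inr v, ⟨H.h (Sum.inr v) - 1, Nat.sub_lt (H.h_pos _) one_pos⟩⟩, ?_⟩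
      rw [next_ofCorner_inr]
      congr 2
      exact Fin.ext ((congrArg (· % _) (Nat.sub_add_cancel (H.h_pos (Sum.inr v)))).trans
        (Nat.mod_self _))
    | succ i =>
      refine ⟨H.ofCorner ⟨Sum.inr v, ⟨i, by omega⟩⟩, ?_⟩
      rw [next_ofCorner_inr]
      simp only [Nat.mod_eq_of_lt hi]
      rfl

open Classical in
/-- The permutation that exchanges the two half-edge vertices of each edge in `T`. -/
noncomputable def exchange (T : Set E) : Equiv.Perm H.PreVertex :=
  Equiv.sumCongr (Function.Involutive.toPerm
    (fun d : E × Bool => if d.1 ∈ T then oppHalfEdge d else d) (fun d => by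
      by_cases h : d.1 ∈ T
      · have : (oppHalfEdge d).1 ∈ T := h
        simp [h, this]
      · simp [h])) (Equiv.refl _)

theorem exchange_ofHalfEdge_of_mem {T : Set E} {d : E × Bool} (h : d.1 ∈ T) :
    H.exchange T (H.ofHalfEdge d) = H.ofHalfEdge (oppHalfEdge d) :=
  congrArg Sum.inl (if_pos h)

theorem exchange_ofHalfEdge_of_notMem {T : Set E} {d : E × Bool} (h : d.1 ∉ T) :
    H.exchange T (H.ofHalfEdge d) = H.ofHalfEdge d :=
  congrArg Sum.inl (if_neg h)

/-- The vertices that are not half-edge vertices of edges in `T`. -/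
def IsKept (T : Set E) (x : H.PreVertex) : Prop := ∀ d, d.1 ∈ T → x ≠ H.ofHalfEdge d

theorem isKept_ofCorner (T : Set E) (c : Σ c : G.Corner, Fin (H.h c)) :
    H.IsKept T (H.ofCorner c) := fun _ _ => H.ofCorner_ne_ofHalfEdge _ _

theorem exists_of_not_isKept {T : Set E} {x : H.PreVertex} (hx : ¬ H.IsKept T x) :
    ∃ d, d.1 ∈ T ∧ x = H.ofHalfEdge d := by
  by_contra h
  exact hx fun d hd hxd => h ⟨d, hd, hxd⟩

/-! ### Rerouted cycles and the bound on feedback vertex sets -/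

section Reroute

variable [Finite V] [Finite E]

/-- The cycles `C_v` as a permutation of the vertices before merging. -/
noncomputable def nextPerm : Equiv.Perm H.PreVertex :=
  Equiv.ofBijective H.next (Finite.injective_iff_bijective.1
    (Finite.injective_iff_surjective.2 H.next_surjective))

/-- The cycles `C_v`, rerouted along the link arcs of the edges in `T`. -/
noncomputable def reroute (T : Set E) : Equiv.Perm H.PreVertex := H.nextPerm * H.exchange T

theorem reroute_apply (T : Set E) (x : H.PreVertex) :
    H.reroute T x = H.next (H.exchange T x) := rfl

theorem reroute_ofCorner (T : Set E) (c : Σ c : G.Corner, Fin (H.h c)) :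
    H.reroute T (H.ofCorner c) = H.next (H.ofCorner c) := rfl

theorem reroute_ofHalfEdge_of_mem {T : Set E} {d : E × Bool} (h : d.1 ∈ T) :
    H.reroute T (H.ofHalfEdge d) = H.next (H.ofHalfEdge (oppHalfEdge d)) := by
  rw [reroute_apply, exchange_ofHalfEdge_of_mem H h]

theorem reroute_ofHalfEdge_of_notMem {T : Set E} {d : E × Bool} (h : d.1 ∉ T) :
    H.reroute T (H.ofHalfEdge d) = H.next (H.ofHalfEdge d) := by
  rw [reroute_apply, exchange_ofHalfEdge_of_notMem H h]

-- This reduces growing `T` by one edge to multiplication by a transposition, so that the cycle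
-- counts above apply.
open Classical in
theorem reroute_insert {T : Set E} {e : E} (he : e ∉ T) : H.reroute (insert e T) =
    H.reroute T * Equiv.swap (H.ofHalfEdge (e, false)) (H.ofHalfEdge (e, true)) := by
  ext x
  rw [Equiv.Perm.mul_apply]
  rcases H.preVertex_cases x with ⟨d, rfl⟩ | ⟨c, rfl⟩
  · by_cases hd : d.1 = e
    · obtain ⟨e', b⟩ := d
      obtain rfl : e' = e := hd
      rw [reroute_ofHalfEdge_of_mem H (d := (e', b)) (Set.mem_insert e' T)]
      cases b
      · rw [Equiv.swap_apply_left, reroute_ofHalfEdge_of_notMem H (by exact he)]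
        rfl
      · rw [Equiv.swap_apply_right, reroute_ofHalfEdge_of_notMem H (by exact he)]
        rfl
    · rw [Equiv.swap_apply_of_ne_of_ne
        (fun h => hd (congrArg Prod.fst (H.ofHalfEdge_injective h)))
        (fun h => hd (congrArg Prod.fst (H.ofHalfEdge_injective h)))]
      by_cases hT : d.1 ∈ T
      · rw [reroute_ofHalfEdge_of_mem H hT,
          reroute_ofHalfEdge_of_mem H (Set.mem_insert_of_mem _ hT)]
      · rw [reroute_ofHalfEdge_of_notMem H hT, reroute_ofHalfEdge_of_notMem H (by simp [hd, hT])]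
  · rw [Equiv.swap_apply_of_ne_of_ne (H.ofCorner_ne_ofHalfEdge _ _) (H.ofCorner_ne_ofHalfEdge _ _)]
    rfl

theorem card_le_numCycles_reroute_empty : Nat.card V ≤ (H.reroute ∅).numCycles := by
  refine Equiv.Perm.card_le_numCycles_of_invariant _ (f := H.owner) (fun x => ?_)
    H.owner_surjective
  rcases H.preVertex_cases x with ⟨d, rfl⟩ | ⟨c, rfl⟩
  · rw [reroute_ofHalfEdge_of_notMem H (Set.notMem_empty _), owner_next]
  · rw [reroute_ofCorner, owner_next]

theorem reroute_of_isKept {T : Set E} {x : H.PreVertex} (hx : H.IsKept T x) :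
    H.reroute T x = H.next x := by
  rcases H.preVertex_cases x with ⟨d, rfl⟩ | ⟨c, rfl⟩
  · exact H.reroute_ofHalfEdge_of_notMem fun hd => hx d hd rfl
  · rfl

/-- Every corner contains a vertex, so no two half-edge vertices are consecutive and one skip always
suffices. -/
theorem isKept_reroute_of_not_isKept {T : Set E} {x : H.PreVertex} (hx : ¬ H.IsKept T x) :
    H.IsKept T (H.reroute T x) := by
  obtain ⟨d, hd, rfl⟩ := H.exists_of_not_isKept hx
  rw [reroute_ofHalfEdge_of_mem H hd, next_ofHalfEdge]
  exact H.isKept_ofCorner T _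

open Classical in
/-- The rerouted cycles, with the half-edge vertices of edges in `T` skipped. -/
noncomputable def shortcut (T : Set E) (x : {x // H.IsKept T x}) : {x // H.IsKept T x} :=
  if h : H.IsKept T (H.reroute T x) then ⟨_, h⟩ else ⟨_, H.isKept_reroute_of_not_isKept h⟩

theorem shortcut_injective (T : Set E) : Function.Injective (H.shortcut T) := by
  rintro ⟨x, hx⟩ ⟨y, hy⟩ h
  have h := congrArg Subtype.val h
  unfold shortcut at h
  split_ifs at h with h1 h2 h2
  · exact Subtype.ext ((H.reroute T).injective h)
  · have := (H.reroute T).injective h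
    exact (h2 (this ▸ hx)).elim
  · have := (H.reroute T).injective h
    exact (h1 (this ▸ hy)).elim
  · exact Subtype.ext ((H.reroute T).injective ((H.reroute T).injective h))

/-- Skipping a half-edge vertex `d` leads from its in-neighbour to the out-neighbour of the opposite
half-edge, which is precisely the link arc. -/
theorem adj_shortcut (T : Set E) (x : {x // H.IsKept T x}) :
    H.digraph.Adj (H.merge x) (H.merge (H.shortcut T x)) := by
  unfold shortcut
  split_ifs with h
  · exact .inl ⟨x, rfl, congrArg H.merge (H.reroute_of_isKept x.2)⟩
  · obtain ⟨d, hd, hx⟩ := H.exists_of_not_isKept h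
    refine .inr ⟨d, x, (H.reroute_of_isKept x.2).symm.trans hx, rfl, ?_⟩
    simp only [hx]
    rw [reroute_ofHalfEdge_of_mem H hd]
    rfl

theorem sameCycle_shortcut (T : Set E) (x : {x // H.IsKept T x}) :
    (H.reroute T).SameCycle (x : H.PreVertex) (H.shortcut T x) := by
  unfold shortcut
  split_ifs
  · exact Equiv.Perm.sameCycle_apply_right.2 (.refl _ _)
  · exact Equiv.Perm.sameCycle_apply_right.2 (Equiv.Perm.sameCycle_apply_right.2 (.refl _ _))

theorem sameCycle_iterate_shortcut (T : Set E) (x : {x // H.IsKept T x}) (i : ℕ) :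
    (H.reroute T).SameCycle (x : H.PreVertex) ((H.shortcut T)^[i] x) := by
  induction i with
  | zero => exact .refl _ _
  | succ i ih =>
    rw [Function.iterate_succ_apply']
    exact ih.trans (H.sameCycle_shortcut T _)

/-- Every rerouted cycle contains the vertices of a directed cycle of the coating that avoids the
link vertices of the edges used for rerouting. -/
theorem exists_isDirectedCycle_of_reroute (T : Set E)
    (q : Quotient (Equiv.Perm.SameCycle.setoid (H.reroute T))) :
    ∃ C : Cycle H.Vertex, H.digraph.IsDirectedCycle C ∧
      C.length ≤ Nat.card {x // H.IsKept T x ∧ Quotient.mk _ x = q} ∧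
      ∀ w ∈ C, ∃ x, w = H.merge x ∧ H.IsKept T x ∧ Quotient.mk _ x = q := by
  obtain ⟨x, rfl, hx⟩ : ∃ x, Quotient.mk _ x = q ∧ H.IsKept T x := by
    induction q using Quotient.inductionOn with
    | h x =>
      by_cases hx : H.IsKept T x
      · exact ⟨x, rfl, hx⟩
      · exact ⟨_, Quotient.sound (Equiv.Perm.sameCycle_apply_left.2 (.refl _ _)),
          H.isKept_reroute_of_not_isKept hx⟩
  set r := H.shortcut T
  set y : {x // H.IsKept T x} := ⟨x, hx⟩
  have hper : y ∈ Function.periodicPts r :=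
    Function.Injective.mem_periodicPts (H.shortcut_injective T) y
  have hq : ∀ i, Quotient.mk (Equiv.Perm.SameCycle.setoid (H.reroute T)) (r^[i] y).1 =
      Quotient.mk _ x := fun i => Quotient.sound (H.sameCycle_iterate_shortcut T y i).symm
  obtain ⟨C, hC, hlen, hmem⟩ := H.digraph.exists_isDirectedCycle_of_isPeriodicPt r
    (fun x => H.merge x) (H.adj_shortcut T) (Function.minimalPeriod_pos_of_mem_periodicPts hper)
    (Function.isPeriodicPt_minimalPeriod r y)
  refine ⟨C, hC, hlen.trans ?_, fun w hw => ?_⟩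
  -- The iterates within one minimal period are distinct kept vertices of the class `q`.
  · rw [← Nat.card_fin (Function.minimalPeriod r y)]
    refine Nat.card_le_card_of_injective (fun i => ⟨(r^[i.1] y).1, (r^[i.1] y).2, hq i⟩) ?_
    intro i j hij
    have hij : r^[i.1] y = r^[j.1] y := Subtype.ext (Subtype.mk.inj hij)
    exact Fin.ext (Function.iterate_injOn_Iio_minimalPeriod i.2 j.2 hij)
  · obtain ⟨i, rfl⟩ := hmem w hw
    exact ⟨_, rfl, (r^[i] y).2, hq i⟩

theorem card_le_numCycles_reroute_add (T : Finset E) :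
    Nat.card V ≤ (H.reroute T).numCycles + T.card := by
  classical
  induction T using Finset.induction_on with
  | empty => simpa using H.card_le_numCycles_reroute_empty
  | insert e T he ih =>
    rw [Finset.coe_insert, H.reroute_insert (by simpa using he), Finset.card_insert_of_notMem he]
    have := (H.reroute T).numCycles_le_numCycles_mul_swap_add_one (H.ofHalfEdge (e, false))
      (H.ofHalfEdge (e, true))
    omega

/-- Vertices of `S` in corners pay for the rerouted cycles, and its link vertices pay for the cycles
lost in rerouting. -/
theorem card_le_fvs : Nat.card V ≤ H.digraph.fvs := by
  classical
  have := Fintype.ofFinite H.Vertex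
  have := Fintype.ofFinite E
  -- The set of all vertices is a feedback set, so the infimum is not the default value of an empty
  -- set.
  refine le_csInf ⟨_, Finset.univ, fun C hC => ?_, rfl⟩ ?_
  · induction C using Cycle.induction_on with
    | nil => exact (hC.1 rfl).elim
    | cons a l => exact ⟨a, by simp, by simp⟩
  rintro k ⟨S, hS, rfl⟩
  set T : Finset E := Finset.univ.filter fun e => (Sum.inl e : H.Vertex) ∈ S
  have hT : ∀ e, e ∈ T ↔ (Sum.inl e : H.Vertex) ∈ S := fun e => Finset.mem_filter_univ e
  set U : Set (Σ c : G.Corner, Fin (H.h c)) := {c | (Sum.inr c : H.Vertex) ∈ S}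
  refine (H.card_le_numCycles_reroute_add T).trans ?_
  have hex : ∀ q : Quotient (Equiv.Perm.SameCycle.setoid (H.reroute T)),
      ∃ c : U, Quotient.mk _ (H.ofCorner c.1) = q := by
    intro q
    obtain ⟨C, hC, -, hmem⟩ := H.exists_isDirectedCycle_of_reroute T q
    obtain ⟨w, hw, hwS⟩ := hS C hC
    obtain ⟨x, rfl, hx, rfl⟩ := hmem w hw
    rcases H.preVertex_cases x with ⟨d, rfl⟩ | ⟨c, rfl⟩
    · exact (hx d ((hT _).2 hwS) rfl).elim
    · exact ⟨⟨c, hwS⟩, rfl⟩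
  choose c hc using hex
  have hinj : Function.Injective fun s : Quotient (Equiv.Perm.SameCycle.setoid (H.reroute T)) ⊕ T =>
      (Sum.elim (fun q => ⟨Sum.inr (c q).1, (c q).2⟩)
        (fun e => ⟨Sum.inl e.1, (hT _).1 e.2⟩) s : S) := by
    have h1 : Function.Injective c := fun q q' h => by rw [← hc q, ← hc q', h]
    rintro (q | e) (q' | e') h
    · have := Sum.inr_injective (congrArg Subtype.val h)
      rw [h1 (Subtype.ext this)]
    · exact (Sum.inr_ne_inl (congrArg Subtype.val h)).elim
    · exact (Sum.inl_ne_inr (congrArg Subtype.val h)).elim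
    · have := Sum.inl_injective (congrArg Subtype.val h)
      rw [Subtype.ext this]
  have := Nat.card_le_card_of_injective _ hinj
  rwa [Nat.card_sum, Nat.card_eq_fintype_card (α := T), Nat.card_eq_fintype_card (α := S),
    Fintype.card_coe, Fintype.card_coe] at this

end Reroute

end Coating

end PlaneGraph

/-! ### Components, even edge sets and the Jordan property -/

namespace PlaneGraph

variable {V E F : Type*} (G : PlaneGraph V E F)

/-- Two vertices are joined by an edge in `T`. -/
def Joined (T : Set E) (u v : V) : Prop :=
  ∃ d : E × Bool, d.1 ∈ T ∧ G.vert d = u ∧ G.vert (oppHalfEdge d) = v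

/-- The number of connected components of the spanning subgraph with edge set `T`. -/
noncomputable def numComponents (T : Set E) : ℕ := Nat.card (Quot (G.Joined T))

theorem Joined.mono {T T' : Set E} (h : T ⊆ T') (u v : V) (huv : G.Joined T u v) :
    G.Joined T' u v := by
  obtain ⟨d, hd, h'⟩ := huv
  exact ⟨d, h hd, h'⟩

theorem quotMap_joined_surjective {T T' : Set E} (h : T ⊆ T') :
    Function.Surjective (Quot.map (id : V → V) (Joined.mono G h)) := by
  rintro ⟨v⟩
  exact ⟨Quot.mk _ v, rfl⟩

theorem numComponents_anti [Finite V] {T T' : Set E} (h : T ⊆ T') :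
    G.numComponents T' ≤ G.numComponents T :=
  Nat.card_le_card_of_surjective _ (G.quotMap_joined_surjective h)

theorem numComponents_insert_lt [Finite V] {T : Set E} {e : E}
    (he : Quot.mk (G.Joined T) (G.vert (e, false)) ≠ Quot.mk (G.Joined T) (G.vert (e, true))) :
    G.numComponents (insert e T) < G.numComponents T := by
  have hs := G.quotMap_joined_surjective (Set.subset_insert e T)
  refine lt_of_le_of_ne (Nat.card_le_card_of_surjective _ hs) fun h => he ?_
  refine ((Nat.bijective_iff_surjective_and_card _).2 ⟨hs, h.symm⟩).1 ?_
  exact Quot.sound ⟨(e, false), Set.mem_insert _ _, rfl, rfl⟩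

theorem numComponents_le_card [Finite V] (T : Set E) : G.numComponents T ≤ Nat.card V :=
  Nat.card_le_card_of_surjective _ Quot.mk_surjective

/-- Collapsing `VS` to one point is constant on components, because all edges of `ES` have their
ends in `VS`; the image has `n - |VS| + 1` points. -/
theorem IsSubgraph.card_lt_numComponents_add [Finite V] {G : PlaneGraph V E F} {VS : Set V}
    {ES : Set E} (h : G.IsSubgraph VS ES) (hVS : VS.Nonempty) :
    Nat.card V < G.numComponents ES + VS.ncard := by
  classical
  set f : V → Option ↥(VSᶜ) := fun v => if hv : v ∈ VS then none else some ⟨v, hv⟩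
  have hf0 : ∀ v ∈ VS, f v = none := fun v hv => dif_pos hv
  have hinv : ∀ u v, G.Joined ES u v → f u = f v := by
    rintro _ _ ⟨d, hd, rfl, rfl⟩
    rw [hf0 _ (h d hd), hf0 _ (h (oppHalfEdge d) hd)]
  have hs : Function.Surjective (Quot.lift f hinv) := by
    rintro (_ | ⟨v, hv⟩)
    · obtain ⟨v, hv⟩ := hVS
      exact ⟨Quot.mk _ v, hf0 v hv⟩
    · exact ⟨Quot.mk _ v, dif_neg hv⟩
  have h1 := Nat.card_le_card_of_surjective _ hs
  rw [Finite.card_option, Nat.card_coe_set_eq] at h1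
  have h2 := Set.ncard_add_ncard_compl VS
  change _ ≤ G.numComponents ES at h1
  omega

section EvenSets

variable [Fintype E]

open Classical in
/-- The degree of `w` modulo two in the set of edges with indicator function `y`. -/
noncomputable def degreeModTwo (y : E → ZMod 2) (w : V) : ZMod 2 :=
  ∑ d : E × Bool, if G.vert d = w then y d.1 else 0

theorem degreeModTwo_add (y z : E → ZMod 2) (w : V) :
    G.degreeModTwo (y + z) w = G.degreeModTwo y w + G.degreeModTwo z w := by
  rw [degreeModTwo, degreeModTwo, degreeModTwo, ← Finset.sum_add_distrib]
  refine Finset.sum_congr rfl fun d _ => ?_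
  split_ifs <;> simp

open Classical in
theorem degreeModTwo_single (d : E × Bool) (w : V) :
    G.degreeModTwo (Pi.single d.1 1) w =
      (if G.vert d = w then 1 else 0) + if G.vert (oppHalfEdge d) = w then 1 else 0 := by
  obtain ⟨e, b⟩ := d
  rw [degreeModTwo, Fintype.sum_prod_type, Fintype.sum_eq_single e fun e' he' => by
    simp [Pi.single_eq_of_ne he']]
  rw [Fintype.sum_bool, add_comm]
  cases b
  · simp [oppHalfEdge]
  · simpa [oppHalfEdge] using add_comm _ _

-- A walk in `T` from `u` to `v`, counted modulo two, has odd degree only at its two ends, and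
-- degree zero everywhere if they coincide.
open Classical in
theorem exists_degreeModTwo_eq {T : Set E} {u v : V}
    (h : Quot.mk (G.Joined T) u = Quot.mk (G.Joined T) v) :
    ∃ y : E → ZMod 2, (∀ e ∉ T, y e = 0) ∧
      ∀ w, G.degreeModTwo y w = (if u = w then 1 else 0) + if v = w then 1 else 0 := by
  have two : ∀ x : ZMod 2, x + x = 0 := fun x => CharTwo.add_self_eq_zero x
  induction Quot.eqvGen_exact h with
  | rel u v huv =>
    obtain ⟨d, hd, rfl, rfl⟩ := huv
    refine ⟨Pi.single d.1 1, fun e he => Pi.single_eq_of_ne (by rintro rfl; exact he hd) _, ?_⟩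
    exact G.degreeModTwo_single d
  | refl u => exact ⟨0, by simp, fun w => by simp [degreeModTwo, two]⟩
  | symm u v _ ih =>
    obtain ⟨y, hy, hw⟩ := ih h.symm
    exact ⟨y, hy, fun w => by rw [hw, add_comm]⟩
  | trans u v w huv hvw ih ih' =>
    obtain ⟨y, hy, hyw⟩ := ih (Quot.eqvGen_sound huv)
    obtain ⟨z, hz, hzw⟩ := ih' (Quot.eqvGen_sound hvw)
    refine ⟨y + z, fun e he => by simp [hy e he, hz e he], fun x => ?_⟩
    rw [degreeModTwo_add, hyw, hzw, add_assoc, ← add_assoc (if v = x then (1 : ZMod 2) else 0),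
      two, zero_add]

theorem even_ncard_of_degreeModTwo_eq_zero {y : E → ZMod 2} {w : V} (h : G.degreeModTwo y w = 0) :
    Even {d : E × Bool | d.1 ∈ {e | y e ≠ 0} ∧ G.vert d = w}.ncard := by
  classical
  rw [← ZMod.natCast_eq_zero_iff_even]
  refine Eq.trans ?_ h
  rw [Set.ncard_eq_toFinset_card', degreeModTwo,
    Finset.card_eq_sum_ones, Nat.cast_sum, Set.toFinset_ofPred, Finset.sum_filter]
  refine Finset.sum_congr rfl fun d _ => ?_
  have h01 : ∀ x : ZMod 2, x ≠ 0 → x = 1 := by decide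
  by_cases h1 : G.vert d = w
  · by_cases h2 : y d.1 = 0
    · simp [h1, h2]
    · simp [h1, h01 _ h2]
  · simp [h1]

end EvenSets

/-- Adding an edge within a component closes a curve, which has the two sides of the edge on its
two sides. -/
theorem exists_faces_separating [Finite E] {T : Set E} {e : E} (he : e ∉ T)
    (h : Quot.mk (G.Joined T) (G.vert (e, false)) = Quot.mk (G.Joined T) (G.vert (e, true))) :
    ∃ X : Set F, Xor (G.face (e, false) ∈ X) (G.face (e, true) ∈ X) ∧
      ∀ d : E × Bool, d.1 ∉ insert e T → (G.face d ∈ X ↔ G.face (oppHalfEdge d) ∈ X) := by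
  classical
  have := Fintype.ofFinite E
  obtain ⟨y, hy, hw⟩ := G.exists_degreeModTwo_eq h
  -- The edge `e` closes the walk to an even set, and its coefficient is 1 because `y` vanishes off
  -- `T`.
  set z : E → ZMod 2 := y + Pi.single e 1 with hz
  obtain ⟨X, hX⟩ := G.jordan {e' | z e' ≠ 0} fun w =>
    G.even_ncard_of_degreeModTwo_eq_zero (by
      have hs := G.degreeModTwo_single (e, false) w
      rw [hz, degreeModTwo_add, hw]
      refine (congrArg₂ (· + ·) rfl hs).trans ?_
      exact CharTwo.add_self_eq_zero _)
  refine ⟨X, (hX e).1 (by simp [hz, hy e he]), fun d hd => ?_⟩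
  obtain ⟨e', b⟩ := d
  have he' : e' ≠ e ∧ e' ∉ T := by simpa using hd
  have := (hX e').not.1 (by simp [hz, hy e' he'.2, Pi.single_eq_of_ne he'.1])
  rw [xor_iff_not_iff, not_not] at this
  cases b
  · exact this
  · exact this.symm

/-! ### Faces along rerouted cycles and the digirth count -/

namespace Coating

variable {G} (H : G.Coating)

/-- The face in which the vertices in a corner lie; for the vertex of a half-edge, the face before
it on its cycle. -/
def faceAt : H.PreVertex → F
  | Sum.inl d => G.face (oppHalfEdge d)
  | Sum.inr ⟨Sum.inl d, _⟩ => G.face d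
  | Sum.inr ⟨Sum.inr v, _⟩ => G.isolatedFace v

theorem faceAt_next_ofCorner (c : Σ c : G.Corner, Fin (H.h c)) :
    H.faceAt (H.next (H.ofCorner c)) = H.faceAt (H.ofCorner c) := by
  obtain ⟨d | v, i⟩ := c
  · rw [next_ofCorner_inl]
    split_ifs
    · rfl
    · exact G.face_rot d
  · rfl

theorem nonempty_of_digirth_ne_top {H : G.Coating} (h : H.digraph.digirth ≠ ⊤) : Nonempty V := by
  by_contra hV
  rw [not_nonempty_iff] at hV
  refine h (iInf₂_eq_top.2 fun C hC => ?_)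
  induction C using Cycle.induction_on with
  | nil => exact (hC.1 rfl).elim
  | cons a l =>
    rcases a with e | c
    · exact hV.elim (G.vert (e, false))
    · exact hV.elim (G.cornerVertex c.1)

variable [Finite V] [Finite E]

/-- A rerouted cycle changes its face only when it crosses an edge outside `insert e T`. Such edges
have both sides in `X` or both outside, whereas `X` separates the two sides of `e`. -/
theorem not_sameCycle_reroute_insert {T : Set E} {e : E} (he : e ∉ T)
    (h : Quot.mk (G.Joined T) (G.vert (e, false)) = Quot.mk (G.Joined T) (G.vert (e, true))) :
    ¬ (H.reroute (insert e T)).SameCycle (H.ofHalfEdge (e, false)) (H.ofHalfEdge (e, true)) := by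
  obtain ⟨X, hX, hXT⟩ := G.exists_faces_separating he h
  intro hs
  have := Equiv.Perm.SameCycle.apply_eq_of_invariant (f := fun x => H.faceAt x ∈ X) (fun x => by
    rcases H.preVertex_cases x with ⟨d, rfl⟩ | ⟨c, rfl⟩
    · by_cases hd : d.1 ∈ insert e T
      · rw [reroute_ofHalfEdge_of_mem H hd]
        rfl
      · rw [reroute_ofHalfEdge_of_notMem H hd]
        exact propext (hXT d hd)
    · rw [reroute_ofCorner, faceAt_next_ofCorner]) hs
  rw [xor_iff_not_iff] at hX
  exact hX (Iff.of_eq this).symm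

/-- An edge within a component gains a cycle, paying for the larger `T`; an edge between components
lowers `2 * numComponents` by at least two, paying for `T` and for the at most one cycle lost. -/
theorem card_add_two_mul_numComponents_le (T : Finset E) :
    T.card + 2 * G.numComponents (T : Set E) ≤ (H.reroute T).numCycles + Nat.card V := by
  classical
  induction T using Finset.induction_on with
  | empty =>
    have h1 := H.card_le_numCycles_reroute_empty
    have h2 := G.numComponents_le_card ∅
    rw [Finset.coe_empty, Finset.card_empty]
    omega
  | insert e T he ih =>
    rw [Finset.coe_insert, Finset.card_insert_of_notMem he]
    have he' : e ∉ (T : Set E) := by simpa using he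
    by_cases h : Quot.mk (G.Joined T) (G.vert (e, false)) = Quot.mk (G.Joined T) (G.vert (e, true))
    · have h1 := H.not_sameCycle_reroute_insert he' h
      rw [H.reroute_insert he'] at h1 ⊢
      have h2 := (H.reroute T).numCycles_lt_numCycles_mul_swap h1
      have h3 := G.numComponents_anti (Set.subset_insert e (T : Set E))
      omega
    · have h1 := G.numComponents_insert_lt h
      have h2 := (H.reroute T).numCycles_le_numCycles_mul_swap_add_one (H.ofHalfEdge (e, false))
        (H.ofHalfEdge (e, true))
      rw [H.reroute_insert he']
      omega

theorem IsGCoating.card_preVertex {H : G.Coating} {g : ℕ} (h : H.IsGCoating g) :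
    Nat.card H.PreVertex = g * Nat.card V := by
  have := Fintype.ofFinite V
  rw [Nat.card_congr (Equiv.sigmaFiberEquiv H.owner).symm, Nat.card_sigma,
    Finset.sum_congr rfl fun v _ => show Nat.card {x // H.owner x = v} = g from h v]
  simp [mul_comm]

theorem IsGCoating.mul_numCycles_reroute_add_le {H : G.Coating} {g : ℕ} (h : H.IsGCoating g)
    (hg : g ≤ H.digraph.digirth) (T : Finset E) :
    g * (H.reroute T).numCycles + 2 * T.card ≤ g * Nat.card V := by
  classical
  set Q := Quotient (Equiv.Perm.SameCycle.setoid (H.reroute T))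
  have hemb : ∀ q : Q, Nonempty
      (Fin g ↪ {x // H.IsKept (T : Set E) x ∧ Quotient.mk _ x = q}) := by
    intro q
    have := Fintype.ofFinite {x // H.IsKept (T : Set E) x ∧ Quotient.mk _ x = q}
    obtain ⟨C, hC, hlen, -⟩ := H.exists_isDirectedCycle_of_reroute T q
    have hgC : g ≤ C.length := by exact_mod_cast hg.trans (Digraph.digirth_le hC)
    refine Function.Embedding.nonempty_of_card_le ?_
    rw [Fintype.card_fin, ← Nat.card_eq_fintype_card]
    exact hgC.trans hlen
  set φ := fun q => (hemb q).some
  -- Disjoint vertices before merging: `g` kept ones for each rerouted cycle and the two skipped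
  -- ones for each edge of `T`.
  set ψ : Q × Fin g ⊕ T × Bool → H.PreVertex :=
    Sum.elim (fun p => (φ p.1 p.2).1) fun p => H.ofHalfEdge (p.1.1, p.2)
  have hinj : Function.Injective ψ := by
    rintro (⟨q, i⟩ | ⟨e, b⟩) (⟨q', i'⟩ | ⟨e', b'⟩) he
    · have he : (φ q i).1 = (φ q' i').1 := he
      obtain rfl : q = q' := by rw [← (φ q i).2.2, ← (φ q' i').2.2, he]
      rw [(φ q).injective (Subtype.ext he)]
    · exact ((φ q i).2.1 (e'.1, b') e'.2 he).elim
    · exact ((φ q' i').2.1 (e.1, b) e.2 he.symm).elim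
    · have he := H.ofHalfEdge_injective he
      rw [Prod.mk.injEq] at he
      exact congrArg Sum.inr (Prod.ext (Subtype.ext he.1) he.2)
  have := Nat.card_le_card_of_injective ψ hinj
  rw [h.card_preVertex, Nat.card_sum, Nat.card_prod, Nat.card_prod, Nat.card_fin,
    Nat.card_eq_fintype_card (α := T), Fintype.card_coe, Nat.card_eq_fintype_card (α := Bool),
    Fintype.card_bool] at this
  change (H.reroute T).numCycles * g + T.card * 2 ≤ _ at this
  linarith

theorem IsGCoating.pos {H : G.Coating} {g : ℕ} (h : H.IsGCoating g) [Nonempty V] : 0 < g := by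
  obtain ⟨x, hx⟩ := H.owner_surjective (Classical.arbitrary V)
  rw [← h (Classical.arbitrary V)]
  have : Nonempty {x // H.owner x = Classical.arbitrary V} := ⟨⟨x, hx⟩⟩
  exact Nat.card_pos

end Coating

end PlaneGraph

/-! ### The bounds on faces and fractional arboricity -/

namespace PlaneGraph

namespace Coating

variable {V E F : Type*} [Finite V] [Finite E] {G : PlaneGraph V E F} {H : G.Coating} {g : ℕ}

theorem IsGCoating.card_faces_le [Finite F] (h : H.IsGCoating g) (hg : H.digraph.digirth = g) :
    Nat.card F ≤ Nat.card V := by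
  have := Fintype.ofFinite E
  have : Nonempty V := H.nonempty_of_digirth_ne_top (by simp [hg])
  by_cases hF : Function.Surjective G.face
  · have h1 : Nat.card F ≤ (H.reroute (Finset.univ : Finset E)).numCycles := by
      refine Equiv.Perm.card_le_numCycles_of_invariant _ (f := H.faceAt) (fun x => ?_) fun f => ?_
      · rcases H.preVertex_cases x with ⟨d, rfl⟩ | ⟨c, rfl⟩
        · rw [reroute_ofHalfEdge_of_mem H (by simp)]
          rfl
        · rw [reroute_ofCorner, faceAt_next_ofCorner]
      · obtain ⟨d, rfl⟩ := hF f
        exact ⟨H.next (H.ofHalfEdge d), rfl⟩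
    have h2 := h.mul_numCycles_reroute_add_le hg.ge Finset.univ
    exact h1.trans (Nat.le_of_mul_le_mul_left (le_of_add_le_left h2) h.pos)
  · rw [Function.Surjective] at hF
    push Not at hF
    obtain ⟨f, hf⟩ := hF
    -- A face incident with no edge cannot be left by crossing edges, so it is the only face; a
    -- finite digirth provides a vertex to compare it with.
    rcases G.face_connected {f} fun d => by simp [hf] with h0 | h0
    · exact (Set.singleton_ne_empty f h0).elim
    · have : Subsingleton F := Set.subsingleton_univ_iff.1 (h0 ▸ Set.subsingleton_singleton)
      exact (Finite.card_le_one_iff_subsingleton.2 this).trans Nat.card_pos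

theorem IsGCoating.mul_ncard_edges_le (h : H.IsGCoating g) (hg : g ≤ H.digraph.digirth)
    {VS : Set V} {ES : Set E} (hS : G.IsSubgraph VS ES) (hVS : VS.Nonempty) :
    (g + 2) * ES.ncard + 2 * g ≤ 2 * g * VS.ncard := by
  have hfin := ES.toFinite
  have h1 := H.card_add_two_mul_numComponents_le hfin.toFinset
  have h2 := h.mul_numCycles_reroute_add_le hg hfin.toFinset
  have h3 := hS.card_lt_numComponents_add hVS
  rw [Set.Finite.coe_toFinset, ← Set.ncard_eq_toFinset_card] at h1 h2
  -- Eliminating the cycle count and then the component count from `h1`, `h2` and `h3`, with weights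
  -- `g`, 1 and `2 * g`, leaves the claim.
  have h4 := Nat.mul_le_mul_left g h1
  have h5 := Nat.mul_le_mul_left (2 * g) (Nat.succ_le_of_lt h3)
  simp only [Nat.succ_eq_add_one] at h5
  nlinarith

theorem IsGCoating.fractionalArboricity_le (h : H.IsGCoating g) (hg : g ≤ H.digraph.digirth) :
    G.fractionalArboricity ≤ 2 * (g : ℝ) / ((g : ℝ) + 2) := by
  -- Nonnegativity of the bound covers the empty supremum, which is 0.
  refine Real.sSup_le ?_ (by positivity)
  rintro x ⟨VS, ES, hS, hVS, rfl⟩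
  have h1 : ((g + 2) * ES.ncard + 2 * g : ℝ) ≤ 2 * g * VS.ncard := by
    exact_mod_cast h.mul_ncard_edges_le hg hS (Set.nonempty_of_ncard_ne_zero (by omega))
  have h2 : (2 : ℝ) ≤ VS.ncard := by exact_mod_cast hVS
  rw [div_le_div_iff₀ (by linarith) (by positivity)]
  linarith

end Coating

end PlaneGraph

theorem mainTheorem9 {V E F : Type*} [Finite V] [Finite E] [Finite F]
    (G : PlaneGraph V E F) (g : ℕ)
    (hG : ∃ H : G.Coating, H.IsGCoating g ∧ H.digraph.digirth = (g : ℕ∞)) :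
    G.fractionalArboricity ≤ 2 * (g : ℝ) / ((g : ℝ) + 2) ∧
    ∀ H : G.Coating, H.IsGCoating g → H.digraph.digirth = (g : ℕ∞) →
      Nat.card V ≤ H.digraph.fvs ∧ Nat.card F ≤ Nat.card V := by
  obtain ⟨H, hH, hg⟩ := hG
  exact ⟨hH.fractionalArboricity_le hg.ge,
    fun H hH hg => ⟨H.card_le_fvs, hH.card_faces_le hg⟩⟩
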